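/- \textbf{Setting.} A game $G=(S_1,S_2,E,w)$ consists of disjoint finite sets $S_1,S_2$ of states of players 1 and 2, with $S=S_1\uplus S_2$, edges $E\subseteq S\times S$ such that every state has an outgoing edge, and integer weights $w\colon E\to\mathbb Z$; $W$ denotes the largest absolute value of a weight. $G$ is one-player if $S_1=\emptyset$ or $S_2=\emptyset$. A play is an infinite path $\rho=s_0s_1\ldots$, with energy levels $\mathrm{EL}(\rho(n))=\sum_{i=0}^{n-1}w(s_i,s_{i+1})$ and average-energy $\overline{\mathrm{AE}}(\rho)=\limsup_{n\to\infty}\frac1n\sum_{i=1}^{n}\mathrm{EL}(\rho(i))$. For $t\in\mathbb Q$, the $AE_L$ objective of player 1 is the set of plays $\rho$ with $\mathrm{EL}(\rho(n))\ge 0$ for all $n\ge 0$ and $\overline{\mathrm{AE}}(\rho)\le t$. A strategy of player $i$ maps each prefix of a play ending in $S_i$ to a successor of its last state; a strategy of player 1 (player 2) is winning from $s_0$ if, against every strategy of the opponent, the unique play from $s_0$ consistent with both strategies belongs (does not belong) to the objective. A strategy has memory $k$ if it is given by a deterministic Moore machine with $k$ memory states $M$, initial state $m_0\in M$, update function $M\times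 S\to M$ and next-move function $M\times S\to S$: on a prefix $s_0\ldots s_n$ it applies the next-move function to $s_n$ and the memory state reached after reading $s_0\ldots s_{n-1}$. It is memoryless if it depends only on the current state. \textbf{Theorem.} \begin{enumerate} \item (Pseudo-polynomial memory suffices for player 1.) There is a polynomial $p$ in three variables with coefficients in $\mathbb N$ such that for every one-player game $G$, initial state $s_0$ and threshold $t\in\mathbb Q$: if player 1 has a winning strategy from $s_0$ for the $AE_L$ objective with threshold $t$, then player 1 has a winning strategy of memory at most $p(|S|,W,\max(\lceil t\rceil,0))$. \item (Pseudo-polynomial memory is necessary for player 1.) For every integer $U\ge 1$ there are a game with $|S|=2$, $S_2=\emptyset$ and $W=U$, and an initial state, such that for the threshold $t=\frac{U(U+1)}{2U+1}$ player 1 has a winning strategy for the $AE_L$ objective, and every finite-memory winning strategy of player 1 has memory at least $U+1$. \item (Memoryless strategies suffice for player 2.) For every one-player game, initial state and threshold $t\in\mathbb Q$: if player 2 has a winning strategy against the $AE_L$ objective, then player 2 has a memoryless winning strategy. \end{enumerate} -/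

import Mathlib

namespace AvgEnergy

/-- The two players. -/
inductive Player
  | one
  | two

/-- A weighted turn-based game graph on the state set `S`: `owner` gives the partition
`S = S₁ ⊎ S₂`. The weight function is only ever evaluated on edges. Every state has an outgoing
edge, so that strategies and infinite plays make sense. -/
structure Game (S : Type*) where
  owner : S → Player
  edge : S → S → Prop
  weight : S → S → ℤ
  total : ∀ s, ∃ s', edge s s'

namespace Game

variable {S : Type*}

/-- The set of states that belong to player `i`. -/
def states (G : Game S) (i : Player) : Set S := {s | G.owner s = i}

/-- A game is one-player if one of the two players owns no state. -/
def OnePlayer (G : Game S) : Prop := G.states .one = ∅ ∨ G.states .two = ∅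

open Classical in
/-- The largest absolute weight of an edge. -/
noncomputable def maxWeight [Fintype S] (G : Game S) : ℕ :=
  (Finset.univ.filter fun e : S × S => G.edge e.1 e.2).sup fun e => (G.weight e.1 e.2).natAbs

/-- A play: an infinite path in the game graph. -/
structure Play (G : Game S) where
  state : ℕ → S
  step : ∀ n, G.edge (state n) (state (n + 1))

variable {G : Game S}

/-- The prefix `s₀ s₁ … sₙ` of a play up to position `n`. -/
def Play.pref (ρ : G.Play) (n : ℕ) : List S := (List.range (n + 1)).map ρ.state

/-- The energy level `EL(ρ(n))`, for initial energy `0`. -/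
def Play.energy (ρ : G.Play) (n : ℕ) : ℤ :=
  ∑ i ∈ Finset.range n, G.weight (ρ.state i) (ρ.state (i + 1))

/-- The average-energy `limsup (1/n) ∑_{i=1}^n EL(ρ(i))`, as an extended real number. -/
noncomputable def Play.avgEnergy (ρ : G.Play) : EReal :=
  Filter.limsup
    (fun n : ℕ => (((1 / (n : ℝ)) * ∑ i ∈ Finset.Icc 1 n, (ρ.energy i : ℝ) : ℝ) : EReal))
    Filter.atTop

variable (G) in
/-- A strategy of player `i` maps each prefix that belongs to player `i` to a successor of its last
state. The values of `move` on other lists are irrelevant. -/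
structure Strategy (i : Player) where
  move : List S → S
  valid : ∀ (ρ : G.Play) (n : ℕ), G.owner (ρ.state n) = i → G.edge (ρ.state n) (move (ρ.pref n))

/-- Consistency of a play with a strategy. -/
def Play.Consistent {i : Player} (ρ : G.Play) (σ : G.Strategy i) : Prop :=
  ∀ n, G.owner (ρ.state n) = i → σ.move (ρ.pref n) = ρ.state (n + 1)

/-- Every state sequence that is a path up to position `n` agrees up to `n` with some play. -/
theorem exists_play_extending (G : Game S) (r : ℕ → S) (n : ℕ)
    (h : ∀ i < n, G.edge (r i) (r (i + 1))) :
    ∃ ρ : G.Play, ∀ i ≤ n, ρ.state i = r i := by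
  choose f hf using G.total
  refine ⟨⟨fun i => if i ≤ n then r i else f^[i - n] (r n), fun i => ?_⟩, fun i hi => by simp [hi]⟩
  rcases lt_trichotomy i n with hi | rfl | hi
  · simpa [hi.le, Nat.succ_le_of_lt hi] using h i hi
  · simpa using hf (r i)
  · have h1 : ¬ i ≤ n := by omega
    have h2 : ¬ i + 1 ≤ n := by omega
    have h3 : i + 1 - n = (i - n) + 1 := by omega
    simp only [h1, h2, if_false, h3, Function.iterate_succ_apply']
    exact hf _

open Classical in
/-- Given strategies of both players, there is exactly one play from `s₀` consistent with both. -/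
theorem existsUnique_outcome (s₀ : S) (σ₁ : G.Strategy .one) (σ₂ : G.Strategy .two) :
    ∃! ρ : G.Play, ρ.state 0 = s₀ ∧ ρ.Consistent σ₁ ∧ ρ.Consistent σ₂ := by
  let mv : S → List S → S := fun s h => if G.owner s = .one then σ₁.move h else σ₂.move h
  let c : ℕ → List S × S := fun n =>
    Nat.rec ([], s₀) (fun _ p => (p.1 ++ [p.2], mv p.2 (p.1 ++ [p.2]))) n
  let r : ℕ → S := fun n => (c n).2
  have hc : ∀ n, (c n).1 = (List.range n).map r := by
    intro n
    induction n with
    | zero => rfl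
    | succ n ih =>
      rw [List.range_succ, List.map_append, ← ih]
      rfl
  have hr : ∀ n, r (n + 1) = mv (r n) ((List.range (n + 1)).map r) := by
    intro n
    have : r (n + 1) = mv (r n) ((c n).1 ++ [r n]) := rfl
    rw [this, hc, List.range_succ, List.map_append]
    rfl
  have hpref : ∀ (ρ : G.Play) n, (∀ i ≤ n, ρ.state i = r i) →
      ρ.pref n = (List.range (n + 1)).map r := by
    intro ρ n h
    refine List.map_congr_left fun i hi => h i ?_
    have := List.mem_range.1 hi
    omega
  have hstep : ∀ n, G.edge (r n) (r (n + 1)) := by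
    intro n
    induction n using Nat.strong_induction_on with
    | _ n ih =>
      obtain ⟨ρ, hρ⟩ := G.exists_play_extending r n ih
      rw [hr, ← hpref ρ n hρ, ← hρ n le_rfl]
      by_cases ho : G.owner (ρ.state n) = .one
      · simpa [mv, ho] using σ₁.valid ρ n ho
      · have ho2 : G.owner (ρ.state n) = .two := by
          cases h : G.owner (ρ.state n)
          · exact absurd h ho
          · rfl
        simpa [mv, ho2] using σ₂.valid ρ n ho2
  refine ⟨⟨r, hstep⟩, ⟨rfl, fun n hn => ?_, fun n hn => ?_⟩, ?_⟩
  · simp only at hn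
    simp only [hr, mv, hn, if_true]
    rfl
  · simp only at hn
    simp only [hr, mv, hn, reduceCtorEq, if_false]
    rfl
  · rintro ⟨q, hq⟩ ⟨h0, h1, h2⟩
    have key : ∀ n, ∀ i ≤ n, q i = r i := by
      intro n
      induction n with
      | zero =>
        intro i hi
        obtain rfl : i = 0 := by omega
        exact h0
      | succ n ih =>
        intro i hi
        rcases Nat.lt_or_ge i (n + 1) with h | h
        · exact ih i (by omega)
        · obtain rfl : i = n + 1 := by omega
          rw [hr, ← hpref ⟨q, hq⟩ n ih, ← ih n le_rfl]
          by_cases ho : G.owner (q n) = .one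
          · simpa [mv, ho] using (h1 n ho).symm
          · have ho2 : G.owner (q n) = .two := by
              cases h : G.owner (q n)
              · exact absurd h ho
              · rfl
            simpa [mv, ho2] using (h2 n ho2).symm
    have : q = r := funext fun n => key n n le_rfl
    subst this
    rfl

/-- The unique play from `s₀` that is consistent with both strategies. -/
noncomputable def outcome (s₀ : S) (σ₁ : G.Strategy .one) (σ₂ : G.Strategy .two) : G.Play :=
  (existsUnique_outcome s₀ σ₁ σ₂).choose

/-- `σ₁` is winning for player 1 from `s₀` for the objective `Obj`. -/
def WinsOne (s₀ : S) (Obj : Set G.Play) (σ₁ : G.Strategy .one) : Prop :=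
  ∀ σ₂ : G.Strategy .two, outcome s₀ σ₁ σ₂ ∈ Obj

/-- `σ₂` is winning for player 2 from `s₀` when player 1 has the objective `Obj`. -/
def WinsTwo (s₀ : S) (Obj : Set G.Play) (σ₂ : G.Strategy .two) : Prop :=
  ∀ σ₁ : G.Strategy .one, outcome s₀ σ₁ σ₂ ∉ Obj

/-- Lower-bounded energy objective with initial energy level `c`. -/
def lowerBounded (G : Game S) (c : ℕ) : Set G.Play := {ρ | ∀ n, 0 ≤ (c : ℤ) + ρ.energy n}

/-- Average-energy objective with threshold `t`. -/
def avgEnergyLevel (G : Game S) (t : ℚ) : Set G.Play := {ρ | ρ.avgEnergy ≤ (((t : ℝ)) : EReal)}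

/-- The `AEL` objective: energy never below zero, from initial energy zero, and average-energy at
most `t`. -/
def AEL (G : Game S) (t : ℚ) : Set G.Play := G.lowerBounded 0 ∩ G.avgEnergyLevel t

end Game

/-- A deterministic Moore machine with memory set `M` that reads the visited states one by one; the
next move is chosen from the current memory and the current state. -/
structure MooreMachine (S M : Type*) where
  init : M
  update : M → S → M
  next : M → S → S

namespace Game

variable {S : Type*} {G : Game S}

/-- The strategy `σ` is encoded by the machine `A`: on a prefix `s₀ … sₙ` of player `i` it plays
`A.next m sₙ`, where `m` is the memory after reading `s₀ … sₙ₋₁`. -/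
def Strategy.EncodedBy {i : Player} (σ : G.Strategy i) {M : Type*} (A : MooreMachine S M) : Prop :=
  ∀ (ρ : G.Play) (n : ℕ), G.owner (ρ.state n) = i →
    σ.move (ρ.pref n) =
      A.next (((List.range n).map ρ.state).foldl A.update A.init) (ρ.state n)

/-- The strategy `σ` can be encoded by a Moore machine with `k` memory states. -/
def Strategy.HasMemory {i : Player} (σ : G.Strategy i) (k : ℕ) : Prop :=
  ∃ A : MooreMachine S (Fin k), σ.EncodedBy A

/-- The strategy `σ` depends only on the current state. -/
def Strategy.Memoryless {i : Player} (σ : G.Strategy i) : Prop :=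
  ∃ f : S → S, ∀ (ρ : G.Play) (n : ℕ), G.owner (ρ.state n) = i → σ.move (ρ.pref n) = f (ρ.state n)

end Game

end AvgEnergy

/-! In a one-player game a strategy is a path, and all constructions below cut a path down to a
lasso without repetitions (`exists_simple_lasso`). For player 1 the path lives in the graph of
configurations (state, energy), which is infinite. A winning play has average-energy below `τ`, for
any `τ` slightly above `t`, so it repeats some configuration of low energy with mean energy below
`τ` in between (`exists_low_closed_segment`). High peaks of the stem and of this cycle can be
lowered without raising the total of energy minus `τ` (`exists_bounded_walk`), so finitely many
configurations suffice. A simple lasso among them has length at most their number `N`, and `τ - t`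
is chosen so small that a mean below `τ` over at most `N` integers is at most `t`. A counter for the
position in the lasso is the memory. The lower bound comes from a game in which `U` identical rounds
must precede a single costly loop, so that the machine has to count them. For player 2
(`exists_winsTwo_of_play_not_mem`) a losing play for player 1 either reaches negative energy, or
contains a cycle of nonzero weight, or has energy determined by the state. In each case a path or
lasso without repeated states, hence a memoryless strategy, violates the objective. -/

namespace AvgEnergy

open Finset

/-! ### Weighted walks and extraction of simple lassos. -/

section Walks

variable {C : Type*}

/-- There is a walk with `k` steps from `a` to `b` in the graph `R`, of total edge cost `x`. -/
def HasWalk (R : C → C → Prop) (g : C → C → ℝ) (a b : C) (k : ℕ) (x : ℝ) : Prop :=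
  ∃ r : ℕ → C, r 0 = a ∧ r k = b ∧ (∀ i < k, R (r i) (r (i + 1))) ∧
    ∑ i ∈ range k, g (r i) (r (i + 1)) = x

variable {R : C → C → Prop} {g : C → C → ℝ} {a b c : C}

theorem HasWalk.of_segment (r : ℕ → C) {m n : ℕ} (hmn : m ≤ n)
    (h : ∀ i, m ≤ i → i < n → R (r i) (r (i + 1))) :
    HasWalk R g (r m) (r n) (n - m) (∑ i ∈ Ico m n, g (r i) (r (i + 1))) := by
  refine ⟨fun i => r (m + i), rfl, by simp [Nat.add_sub_cancel' hmn],
    fun i hi => h (m + i) (by omega) (by omega), ?_⟩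
  rw [sum_Ico_eq_sum_range]
  rfl

theorem HasWalk.trans {k l : ℕ} {x y : ℝ} (h₁ : HasWalk R g a b k x) (h₂ : HasWalk R g b c l y) :
    HasWalk R g a c (k + l) (x + y) := by
  obtain ⟨r, r0, rk, hr, hx⟩ := h₁
  obtain ⟨s, s0, sl, hs, hy⟩ := h₂
  have hlow : ∀ i ≤ k, (if i ≤ k then r i else s (i - k)) = r i := fun i hi => by simp [hi]
  have hhigh : ∀ i, (if k + i ≤ k then r (k + i) else s (k + i - k)) = s i := by
    intro i
    rcases Nat.eq_zero_or_pos i with rfl | hi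
    · simp [rk, s0]
    · simp [hi.ne']
  refine ⟨fun i => if i ≤ k then r i else s (i - k), by simp [r0], ?_, ?_, ?_⟩
  · exact (hhigh l).trans sl
  · intro i hi
    rcases Nat.lt_or_ge i k with h | h
    · simp only [hlow i h.le, hlow (i + 1) h]
      exact hr i h
    · obtain ⟨j, rfl⟩ := Nat.exists_eq_add_of_le h
      simp only [add_assoc k j 1, hhigh j, hhigh (j + 1)]
      exact hs j (by omega)
  · rw [sum_range_add, ← hx, ← hy]
    congr 1
    · refine sum_congr rfl fun i hi => ?_
      have hi := mem_range.1 hi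
      simp only [hlow i hi.le, hlow (i + 1) hi]
    · refine sum_congr rfl fun i _ => ?_
      simp only [add_assoc k i 1, hhigh i, hhigh (i + 1)]

/-- A reachable closed walk of positive cost yields a lasso without repetitions whose cycle has
positive cost. -/
theorem exists_simple_lasso {s x : C} {j k : ℕ} {d e : ℝ} (hpre : HasWalk R g s x j d)
    (hcyc : HasWalk R g x x k e) (he : 0 < e) :
    ∃ (r : ℕ → C) (p q : ℕ), 0 < q ∧ r 0 = s ∧ (∀ i < p + q, R (r i) (r (i + 1))) ∧
      r (p + q) = r p ∧ Set.InjOn r (Set.Iio (p + q)) ∧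
      0 < ∑ i ∈ Ico p (p + q), g (r i) (r (i + 1)) := by
  classical
  have hP : ∃ k x j d e, HasWalk R g s x j d ∧ HasWalk R g x x k e ∧ 0 < e :=
    ⟨k, x, j, d, e, hpre, hcyc, he⟩
  -- The cycle length `q` is minimised before the stem length `p`; both minimalities together
  -- exclude every repetition.
  obtain ⟨q, hq, hqmin⟩ : ∃ q, (∃ x j d e, HasWalk R g s x j d ∧ HasWalk R g x x q e ∧ 0 < e) ∧
      ∀ q', (∃ x j d e, HasWalk R g s x j d ∧ HasWalk R g x x q' e ∧ 0 < e) → q ≤ q' :=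
    ⟨Nat.find hP, Nat.find_spec hP, fun q' h => Nat.find_min' hP h⟩
  have hQ : ∃ j x d e, HasWalk R g s x j d ∧ HasWalk R g x x q e ∧ 0 < e := by
    obtain ⟨x, j, d, e, h⟩ := hq
    exact ⟨j, x, d, e, h⟩
  obtain ⟨p, hp, hpmin⟩ : ∃ p, (∃ x d e, HasWalk R g s x p d ∧ HasWalk R g x x q e ∧ 0 < e) ∧
      ∀ p', (∃ x d e, HasWalk R g s x p' d ∧ HasWalk R g x x q e ∧ 0 < e) → p ≤ p' :=
    ⟨Nat.find hQ, Nat.find_spec hQ, fun q' h => Nat.find_min' hQ h⟩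
  obtain ⟨x, d, e, ⟨a, a0, ap, ha, -⟩, ⟨b, b0, bq, hb, hbe⟩, he⟩ := hp
  have hq0 : 0 < q := by
    rcases Nat.eq_zero_or_pos q with rfl | h
    · simp at hbe
      exact absurd hbe.symm he.ne'
    · exact h
  let r : ℕ → C := fun i => if i ≤ p then a i else b (i - p)
  have hlow : ∀ i ≤ p, r i = a i := fun i hi => by simp [r, hi]
  have hhigh : ∀ i, r (p + i) = b i := by
    intro i
    rcases Nat.eq_zero_or_pos i with rfl | hi
    · simp [r, ap, b0]
    · simp [r, hi.ne']
  have hr : ∀ i < p + q, R (r i) (r (i + 1)) := by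
    intro i hi
    rcases Nat.lt_or_ge i p with h | h
    · rw [hlow i h.le, hlow (i + 1) h]
      exact ha i h
    · obtain ⟨j, rfl⟩ := Nat.exists_eq_add_of_le h
      rw [add_assoc p j 1, hhigh j, hhigh (j + 1)]
      exact hb j (by omega)
  have hclose : r (p + q) = r p := by
    have := hhigh 0
    rw [add_zero] at this
    rw [hhigh, this, b0, bq]
  have hsum : ∑ i ∈ Ico p (p + q), g (r i) (r (i + 1)) = e := by
    rw [sum_Ico_eq_sum_range, ← hbe, Nat.add_sub_cancel_left]
    refine sum_congr rfl fun i _ => ?_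
    rw [add_assoc p i 1, hhigh i, hhigh (i + 1)]
  have seg : ∀ m n, m ≤ n → n ≤ p + q →
      HasWalk R g (r m) (r n) (n - m) (∑ i ∈ Ico m n, g (r i) (r (i + 1))) :=
    fun m n hmn hn => HasWalk.of_segment r hmn fun i _ hi => hr i (by omega)
  have r0 : r 0 = s := by rw [hlow 0 (by omega), a0]
  have key : ∀ m n, m < n → n < p + q → r m ≠ r n := by
    intro m n hmn hn hEq
    rcases Nat.lt_or_ge p n with hpn | hpn
    -- A point shared by stem and cycle lets the rotated cycle start there, with a shorter stem. A
    -- repetition inside the cycle splits it into two shorter closed walks, one of them of positive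
    -- cost.
    · rcases Nat.lt_or_ge m p with hmp | hmp
      · have h1 := seg 0 m (by omega) (by omega)
        have h2 := seg n (p + q) hn.le le_rfl
        have h3 := seg p n hpn.le hn.le
        rw [hclose] at h2
        have h4 := h2.trans h3
        rw [← hEq, add_comm (∑ i ∈ Ico n (p + q), _), sum_Ico_consecutive _ hpn.le hn.le, hsum,
          show p + q - n + (n - p) = q by omega] at h4
        rw [r0] at h1
        have := hpmin _ ⟨_, _, _, h1, h4, he⟩
        omega
      · have h0m := seg 0 m (by omega) (by omega)
        have h0p := seg 0 p (by omega) (by omega)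
        have hpm := seg p m hmp (by omega)
        have hmn' := seg m n hmn.le hn.le
        have hnq := seg n (p + q) hn.le le_rfl
        rw [r0] at h0m h0p
        rw [← hEq] at hmn' hnq
        rw [hclose] at hnq
        have h4 := hpm.trans hnq
        rcases lt_or_ge 0 (∑ i ∈ Ico m n, g (r i) (r (i + 1))) with h | h
        · have := hqmin _ ⟨_, _, _, _, h0m, hmn', h⟩
          omega
        · have h5 := sum_Ico_consecutive (fun i => g (r i) (r (i + 1))) hmp hmn.le
          have h6 := sum_Ico_consecutive (fun i => g (r i) (r (i + 1))) hpn.le hn.le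
          have := hqmin _ ⟨_, _, _, _, h0p, h4, by linarith⟩
          omega
    · have h1 := seg 0 m (by omega) (by omega)
      have h2 := seg n p hpn (by omega)
      have h3 := seg p (p + q) (by omega) le_rfl
      rw [r0, hEq] at h1
      rw [hclose, hsum, Nat.add_sub_cancel_left] at h3
      have := hpmin _ ⟨_, _, _, h1.trans h2, h3, he⟩
      omega
  refine ⟨r, p, q, hq0, r0, hr, hclose, ?_, hsum ▸ he⟩
  intro m hm n hn hEq
  rcases lt_trichotomy m n with h | h | h
  · exact absurd hEq (key m n h hn)
  · exact h
  · exact absurd hEq.symm (key n m h hm)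

end Walks

/-! ### Sums along lassos and sequences of periodic growth. -/

section Lasso

/-- Successor of a position in a lasso with stem length `p` and cycle length `q`. -/
def lassoSucc (p q i : ℕ) : ℕ := if i + 1 < p + q then i + 1 else p

/-- Position in a lasso with stem length `p` and cycle length `q` after `n` steps. -/
def lassoPos (p q n : ℕ) : ℕ := (lassoSucc p q)^[n] 0

variable {p q : ℕ}

theorem lassoPos_succ (n : ℕ) : lassoPos p q (n + 1) = lassoSucc p q (lassoPos p q n) :=
  Function.iterate_succ_apply' _ _ _

theorem lassoSucc_lt (hq : 0 < q) (i : ℕ) : lassoSucc p q i < p + q := by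
  unfold lassoSucc; split <;> omega

theorem lassoPos_lt (hq : 0 < q) (n : ℕ) : lassoPos p q n < p + q := by
  cases n with
  | zero => simp only [lassoPos, Function.iterate_zero, id]; omega
  | succ n => rw [lassoPos_succ]; exact lassoSucc_lt hq _

theorem lassoPos_of_lt {n : ℕ} (hn : n < p + q) : lassoPos p q n = n := by
  induction n with
  | zero => rfl
  | succ n ih => rw [lassoPos_succ, ih (by omega), lassoSucc, if_pos hn]

theorem lassoPos_add (hq : 0 < q) {n : ℕ} (hn : p ≤ n) : lassoPos p q (n + q) = lassoPos p q n := by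
  induction n, hn using Nat.le_induction with
  | base =>
    obtain ⟨q, rfl⟩ := Nat.exists_eq_succ_of_ne_zero hq.ne'
    rw [lassoPos_of_lt (n := p) (by omega), Nat.succ_eq_add_one, ← add_assoc, lassoPos_succ,
      lassoPos_of_lt (by omega), lassoSucc, if_neg (by omega)]
  | succ n hn ih => rw [show n + 1 + q = n + q + 1 by omega, lassoPos_succ, ih, lassoPos_succ]

/-- In a lasso, moving to the next position agrees with moving along the sequence. -/
theorem lasso_apply_succ {C : Type*} {r : ℕ → C} (hclose : r (p + q) = r p) {i : ℕ}
    (hi : i < p + q) : r (lassoSucc p q i) = r (i + 1) := by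
  unfold lassoSucc
  split
  · rfl
  · rw [show i + 1 = p + q by omega, hclose]

/-- Partial sums along a lasso grow by the cycle sum over each period. -/
theorem sum_lasso_add (hq : 0 < q) (φ : ℕ → ℝ) {n : ℕ} (hn : p ≤ n) :
    ∑ i ∈ range (n + q), φ (lassoPos p q i) =
      ∑ i ∈ range n, φ (lassoPos p q i) + ∑ i ∈ Ico p (p + q), φ i := by
  induction n, hn using Nat.le_induction with
  | base =>
    rw [← sum_range_add_sum_Ico _ (show p ≤ p + q by omega)]
    congr 1
    refine sum_congr rfl fun i hi => ?_
    rw [lassoPos_of_lt (mem_Ico.1 hi).2]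
  | succ n hn ih =>
    rw [show n + 1 + q = n + q + 1 by omega, sum_range_succ, ih, sum_range_succ,
      lassoPos_add hq hn]
    ring

/-- A sequence that grows by `δ` over every period of length `q` grows at least linearly. -/
theorem exists_linear_lower_bound {f : ℕ → ℝ} {δ : ℝ} (hδ : 0 ≤ δ) (hq : 0 < q)
    (h : ∀ n, p ≤ n → f n + δ ≤ f (n + q)) : ∃ D : ℝ, ∀ n : ℕ, δ / q * n - D ≤ f n := by
  have hq' : (0 : ℝ) < q := by exact_mod_cast hq
  -- This constant covers all `n < p + q`; larger `n` follow by steps of `q`.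
  refine ⟨∑ i ∈ range (p + q), |f i| + δ / q * (p + q), fun n => ?_⟩
  induction n using Nat.strong_induction_on with
  | _ n ih =>
    rcases Nat.lt_or_ge n (p + q) with hn | hn
    · have h1 := single_le_sum (f := fun i => |f i|) (fun i _ => abs_nonneg (f i))
        (mem_range.2 hn)
      have h2 : δ / q * n ≤ δ / q * (p + q) := by
        have : (n : ℝ) ≤ p + q := by exact_mod_cast hn.le
        gcongr
      have h3 := neg_abs_le (f n)
      linarith
    · obtain ⟨m, rfl⟩ := Nat.exists_eq_add_of_le' (show q ≤ n by omega)
      have h1 := ih m (by omega)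
      have h2 := h m (by omega)
      have h3 : δ / q * q = δ := by field_simp
      push_cast
      linarith [mul_add (δ / q) (m : ℝ) q]

/-- If a function of time does not decrease between visits of the same point of a finite set, it
is bounded below at all visits of that set. -/
theorem exists_lower_bound_of_visits {C : Type*} (x : ℕ → C) (f : ℕ → ℝ) {A : Set C}
    (hA : A.Finite) (h : ∀ i j, i < j → x i = x j → x i ∈ A → f i ≤ f j) :
    ∃ M : ℝ, ∀ n, x n ∈ A → M ≤ f n := by
  classical
  have hc : ∀ c, ∃ M : ℝ, c ∈ A → ∀ n, x n = c → M ≤ f n := by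
    intro c
    by_cases hv : ∃ n, x n = c
    · refine ⟨f (Nat.find hv), fun hcA n hn => ?_⟩
      have h0 := Nat.find_spec hv
      rcases (Nat.find_min' hv hn).eq_or_lt with h1 | h1
      · rw [h1]
      · exact h _ _ h1 (h0.trans hn.symm) (h0.symm ▸ hcA)
    · exact ⟨0, fun _ n hn => absurd ⟨n, hn⟩ hv⟩
  choose M hM using hc
  obtain ⟨m, hm⟩ := (hA.image M).bddBelow
  exact ⟨m, fun n hn => (hm ⟨_, hn, rfl⟩).trans (hM _ hn n rfl)⟩

end Lasso

/-! ### Average-energy through sums of deviations from a threshold. -/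

section AverageEnergy

variable {S : Type*} {G : Game S}

open Game Filter

theorem Game.Play.energy_zero (ρ : G.Play) : ρ.energy 0 = 0 := by simp [Play.energy]

theorem Game.Play.energy_succ (ρ : G.Play) (n : ℕ) :
    ρ.energy (n + 1) = ρ.energy n + G.weight (ρ.state n) (ρ.state (n + 1)) := by
  simp [Play.energy, sum_range_succ]

/-- Index `0` has energy `0` and can be added for free, which is why `n + 1` copies of `t` appear.
This turns averages into unnormalised sums. -/
theorem Game.Play.sum_Icc_energy (ρ : G.Play) (t : ℝ) (n : ℕ) :
    ∑ i ∈ Icc 1 n, (ρ.energy i : ℝ) =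
      ∑ i ∈ range (n + 1), ((ρ.energy i : ℝ) - t) + (n + 1) * t := by
  rw [sum_sub_distrib, sum_const, card_range, nsmul_eq_mul, range_eq_Ico,
    sum_eq_sum_Ico_succ_bot (by omega), ρ.energy_zero]
  push_cast
  rw [show Ico (0 + 1) (n + 1) = Icc 1 n from rfl]
  ring

/-- If the sums of the deviations of the energy from `t` are bounded above, the average-energy is at
most `t`. -/
theorem Game.Play.avgEnergy_le (ρ : G.Play) {t D : ℝ}
    (h : ∀ n, ∑ i ∈ range n, ((ρ.energy i : ℝ) - t) ≤ D) : ρ.avgEnergy ≤ (t : EReal) := by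
  have hlim : Tendsto (fun n : ℕ => ((t + (D + t) * (1 / (n : ℝ)) : ℝ) : EReal)) atTop
      (nhds (t : EReal)) := by
    refine (continuous_coe_real_ereal.tendsto _).comp ?_
    simpa using (tendsto_one_div_atTop_nhds_zero_nat.const_mul (D + t)).const_add t
  rw [← hlim.limsup_eq]
  refine limsup_le_limsup ?_
  filter_upwards [eventually_gt_atTop 0] with n hn
  have hn' : (0 : ℝ) < n := by exact_mod_cast hn
  refine EReal.coe_le_coe_iff.2 ?_
  rw [ρ.sum_Icc_energy t n]
  have h1 := h (n + 1)
  calc 1 / (n : ℝ) * (∑ i ∈ range (n + 1), ((ρ.energy i : ℝ) - t) + (n + 1) * t)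
      ≤ 1 / (n : ℝ) * (D + (n + 1) * t) := by gcongr
    _ = t + (D + t) * (1 / (n : ℝ)) := by field_simp; ring

/-- If the average-energy is less than `τ`, the sums of the deviations of the energy from `τ` are
unbounded below. -/
theorem Game.Play.exists_sum_lt (ρ : G.Play) {t τ : ℝ} (htτ : t < τ)
    (h : ρ.avgEnergy ≤ (t : EReal)) (M : ℝ) :
    ∃ n, ∑ i ∈ range n, ((ρ.energy i : ℝ) - τ) < M := by
  -- The midpoint leaves a gap of `(τ - t) / 2` per step, which eventually outweighs `M`.
  have h1 : ρ.avgEnergy < (((t + τ) / 2 : ℝ) : EReal) :=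
    h.trans_lt (EReal.coe_lt_coe_iff.2 (by linarith))
  have h2 := eventually_lt_of_limsup_lt h1
  have h3 : Tendsto (fun n : ℕ => (n : ℝ) * ((τ - t) / 2)) atTop atTop :=
    tendsto_natCast_atTop_atTop.atTop_mul_const (by linarith)
  obtain ⟨n, hn, hn0, hnM⟩ :=
    (h2.and ((eventually_gt_atTop 0).and (h3.eventually_gt_atTop (- τ - M)))).exists
  have hn' : (0 : ℝ) < n := by exact_mod_cast hn0
  refine ⟨n + 1, ?_⟩
  have h4 := EReal.coe_lt_coe_iff.1 hn
  rw [ρ.sum_Icc_energy τ n, one_div, inv_mul_lt_iff₀ hn'] at h4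
  linarith

/-- If the sums of the deviations of the energy from `t` grow linearly, the average-energy exceeds
`t`. -/
theorem Game.Play.lt_avgEnergy (ρ : G.Play) {t c D : ℝ} (hc : 0 < c)
    (h : ∀ n : ℕ, c * n - D ≤ ∑ i ∈ range n, ((ρ.energy i : ℝ) - t)) :
    (t : EReal) < ρ.avgEnergy := by
  by_contra hle
  obtain ⟨n, hn⟩ := ρ.exists_sum_lt (show t < t + c by linarith) (not_lt.1 hle) (-D)
  have h1 := h n
  have h2 : ∑ i ∈ range n, ((ρ.energy i : ℝ) - (t + c)) =
      ∑ i ∈ range n, ((ρ.energy i : ℝ) - t) - c * n := by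
    simp only [sum_sub_distrib, sum_const, card_range, nsmul_eq_mul]
    ring
  linarith

theorem Game.abs_weight_le [Fintype S] {s s' : S} (h : G.edge s s') :
    |G.weight s s'| ≤ G.maxWeight := by
  classical
  rw [Int.abs_eq_natAbs]
  unfold maxWeight
  exact_mod_cast le_sup (f := fun e : S × S => (G.weight e.1 e.2).natAbs) (b := (s, s'))
    (mem_filter.2 ⟨mem_univ _, h⟩)

theorem Game.outcome_spec (s₀ : S) (σ₁ : G.Strategy .one) (σ₂ : G.Strategy .two) :
    (outcome s₀ σ₁ σ₂).state 0 = s₀ ∧ (outcome s₀ σ₁ σ₂).Consistent σ₁ ∧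
      (outcome s₀ σ₁ σ₂).Consistent σ₂ :=
  (existsUnique_outcome s₀ σ₁ σ₂).choose_spec.1

theorem Game.nonempty_strategy_of_states_eq_empty {i : Player} (h : G.states i = ∅) (s₀ : S) :
    Nonempty (G.Strategy i) :=
  ⟨⟨fun _ => s₀, fun ρ n hn => absurd (show ρ.state n ∈ G.states i from hn) (by simp [h])⟩⟩

theorem Game.owner_eq_one (h : G.states .two = ∅) (s : S) : G.owner s = .one := by
  cases ho : G.owner s
  · rfl
  · exact absurd (show s ∈ G.states .two from ho) (by simp [h])

theorem Game.owner_eq_two (h : G.states .one = ∅) (s : S) : G.owner s = .two := by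
  cases ho : G.owner s
  · exact absurd (show s ∈ G.states .one from ho) (by simp [h])
  · rfl

end AverageEnergy

/-! ### From lassos of configurations to finite-memory strategies. -/

section Machines

variable {S : Type*} {G : Game S}

open Game

theorem Game.Play.pref_eq_append (ρ : G.Play) (n : ℕ) :
    ρ.pref n = (List.range n).map ρ.state ++ [ρ.state n] := by
  simp [Play.pref, List.range_succ]

/-- A Moore machine all of whose moves follow edges induces a strategy. -/
noncomputable def MooreMachine.toStrategy {M : Type*} (A : MooreMachine S M) (s₀ : S)
    (i : Player) (hA : ∀ m s, G.edge s (A.next m s)) : G.Strategy i where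
  move h := A.next (h.dropLast.foldl A.update A.init) (h.getLast?.getD s₀)
  valid ρ n _ := by
    have h : (ρ.pref n).getLast?.getD s₀ = ρ.state n := by simp [ρ.pref_eq_append]
    rw [h]
    exact hA _ _

theorem MooreMachine.toStrategy_encodedBy {M : Type*} (A : MooreMachine S M) (s₀ : S)
    (i : Player) (hA : ∀ m s, G.edge s (A.next m s)) :
    (A.toStrategy s₀ i hA).EncodedBy A := by
  intro ρ n _
  simp [MooreMachine.toStrategy, ρ.pref_eq_append]

/-- The memory state of a machine before the `n`-th move. -/
def MooreMachine.memory {M : Type*} (A : MooreMachine S M) (x : ℕ → S) (n : ℕ) : M :=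
  ((List.range n).map x).foldl A.update A.init

theorem MooreMachine.memory_succ {M : Type*} (A : MooreMachine S M) (x : ℕ → S) (n : ℕ) :
    A.memory x (n + 1) = A.update (A.memory x n) (x n) := by
  simp [memory, List.range_succ]

/-- A lasso of configurations with nonnegative energy whose cycle has mean energy at most `t` yields
a winning strategy whose memory is the length of the lasso. -/
theorem Game.exists_winsOne_of_lasso (h2 : G.states .two = ∅) {s₀ : S} {t : ℚ} {r : ℕ → S × ℤ}
    {p q : ℕ} (hq : 0 < q) (hr0 : r 0 = (s₀, 0)) (hclose : r (p + q) = r p)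
    (hedge : ∀ i < p + q, G.edge (r i).1 (r (i + 1)).1)
    (hweight : ∀ i < p + q, (r (i + 1)).2 = (r i).2 + G.weight (r i).1 (r (i + 1)).1)
    (hpos : ∀ i < p + q, 0 ≤ (r i).2)
    (hmean : ∑ i ∈ Ico p (p + q), (((r i).2 : ℝ) - t) ≤ 0) :
    ∃ σ : G.Strategy .one, WinsOne s₀ (G.AEL t) σ ∧ σ.HasMemory (p + q) := by
  classical
  choose f hf using G.total
  -- The memory is only a position counter and ignores what it reads; `f` makes the moves legal off
  -- the lasso.
  let A : MooreMachine S (Fin (p + q)) :=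
    { init := ⟨0, by omega⟩
      update := fun m _ => ⟨lassoSucc p q m, lassoSucc_lt hq m⟩
      next := fun m s => if G.edge s (r (m + 1)).1 then (r (m + 1)).1 else f s }
  have hA : ∀ m s, G.edge s (A.next m s) := by
    intro m s
    by_cases h : G.edge s (r (m + 1)).1
    · simp [A, h]
    · simpa [A, h] using hf s
  refine ⟨A.toStrategy s₀ .one hA, fun σ₂ => ?_, A, A.toStrategy_encodedBy s₀ .one hA⟩
  obtain ⟨h0, hcons, -⟩ := outcome_spec s₀ (A.toStrategy s₀ .one hA) σ₂
  generalize outcome s₀ (A.toStrategy s₀ .one hA) σ₂ = ρ at h0 hcons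
  have hmem : ∀ n, (A.memory ρ.state n : ℕ) = lassoPos p q n := by
    intro n
    induction n with
    | zero => rfl
    | succ n ih => rw [A.memory_succ, lassoPos_succ, ← ih]
  have hstate : ∀ n, (ρ.state n, ρ.energy n) = r (lassoPos p q n) := by
    intro n
    induction n with
    | zero => rw [h0, ρ.energy_zero, ← hr0]; rfl
    | succ n ih =>
      have hlt := lassoPos_lt (p := p) hq n
      have hs : ρ.state n = (r (lassoPos p q n)).1 := congrArg Prod.fst ih
      have he : ρ.energy n = (r (lassoPos p q n)).2 := congrArg Prod.snd ih
      have hnext : ρ.state (n + 1) = (r (lassoPos p q n + 1)).1 := by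
        rw [← hcons n (owner_eq_one h2 _), A.toStrategy_encodedBy s₀ .one hA ρ n (owner_eq_one h2 _)]
        change A.next (A.memory ρ.state n) (ρ.state n) = _
        simp only [A]
        rw [hmem n, hs, if_pos (hedge _ hlt)]
      rw [lassoPos_succ, lasso_apply_succ hclose hlt, ρ.energy_succ, hnext, hs, he,
        ← hweight _ hlt]
  have henergy : ∀ n, ρ.energy n = (r (lassoPos p q n)).2 := fun n => congrArg Prod.snd (hstate n)
  refine ⟨fun n => ?_, ?_⟩
  · rw [henergy]
    simpa using hpos _ (lassoPos_lt hq n)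
  · obtain ⟨D, hD⟩ := exists_linear_lower_bound (p := p) (q := q) (δ := 0)
      (f := fun n => -∑ i ∈ range n, ((ρ.energy i : ℝ) - t)) le_rfl hq (by
        intro n hn
        simp only [henergy]
        rw [sum_lasso_add hq (fun i => ((r i).2 : ℝ) - t) hn]
        linarith)
    refine ρ.avgEnergy_le (D := D) fun n => ?_
    have := hD n
    simp only [zero_div, zero_mul] at this
    linarith

end Machines

/-! ### Player 1: bounding the energy and the memory. -/

section BoundedEnergy

variable {S : Type*} {G : Game S}

open Game

/-- The step relation between configurations (state and energy level), restricted to the energy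
levels in `P`. -/
def Game.ConfigStep (G : Game S) (P : ℤ → Prop) (c c' : S × ℤ) : Prop :=
  G.edge c.1 c'.1 ∧ c'.2 = c.2 + G.weight c.1 c'.1 ∧ P c.2 ∧ P c'.2

theorem exists_last_le {e : ℕ → ℤ} {l : ℤ} {m : ℕ} (h0 : e 0 ≤ l) (hm : l < e m) :
    ∃ u < m, e u ≤ l ∧ ∀ i, u < i → i ≤ m → l < e i := by
  induction m with
  | zero => omega
  | succ m ih =>
    rcases lt_or_ge l (e m) with h | h
    · obtain ⟨u, hu, hl, hi⟩ := ih h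
      refine ⟨u, by omega, hl, fun i h1 h2 => ?_⟩
      rcases Nat.lt_or_ge m i with h3 | h3
      · obtain rfl : i = m + 1 := by omega
        exact hm
      · exact hi i h1 h3
    · refine ⟨m, by omega, h, fun i h1 h2 => ?_⟩
      obtain rfl : i = m + 1 := by omega
      exact hm

theorem exists_first_le {e : ℕ → ℤ} {l : ℤ} {m k : ℕ} (hmk : m ≤ k) (hk : e k ≤ l)
    (hm : l < e m) : ∃ d, m < d ∧ d ≤ k ∧ e d ≤ l ∧ ∀ i, m ≤ i → i < d → l < e i := by
  classical
  have hex : ∃ d, m ≤ d ∧ e d ≤ l := ⟨k, hmk, hk⟩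
  obtain ⟨h1, h2⟩ := Nat.find_spec hex
  refine ⟨Nat.find hex, ?_, Nat.find_min' hex ⟨hmk, hk⟩, h2, fun i hi hlt => ?_⟩
  · rcases h1.eq_or_lt with h | h
    · rw [← h] at h2
      omega
    · exact h
  · have := Nat.find_min hex hlt
    by_contra hcon
    exact this ⟨hi, not_lt.1 hcon⟩

/-- A walk with nonnegative energy between configurations of energy at most `L` that exceeds level
`L + W + |S|² (W + 1)²` can be shortened by removing positions of energy at least `L` and lowering
others. -/
theorem Game.exists_shorter_walk [Fintype S] {L : ℤ} {τ : ℝ} (hL : 0 ≤ L) (hτ : τ ≤ L)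
    {r : ℕ → S × ℤ} {k m : ℕ} (hr : ∀ i < k, G.ConfigStep (0 ≤ ·) (r i) (r (i + 1)))
    (h0 : (r 0).2 ≤ L) (hk : (r k).2 ≤ L) (hmk : m ≤ k)
    (hm : L + G.maxWeight + Fintype.card S ^ 2 * (G.maxWeight + 1) ^ 2 < (r m).2) :
    ∃ k' < k, ∃ x', ∑ i ∈ range k, (τ - (r i).2) ≤ x' ∧
      HasWalk (G.ConfigStep (0 ≤ ·)) (fun c _ => τ - c.2) (r 0) (r k) k' x' := by
  classical
  set W : ℤ := (G.maxWeight : ℤ) with hW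
  have hW0 : 0 ≤ W := by simp [hW]
  set Q : ℕ := Fintype.card S ^ 2 * (G.maxWeight + 1) ^ 2 with hQ
  have hmQ : L + W + Q < (r m).2 := by
    rw [hQ]
    push_cast
    exact hm
  have hstep : ∀ i < k, |(r (i + 1)).2 - (r i).2| ≤ W := by
    intro i hi
    obtain ⟨h1, h2, -⟩ := hr i hi
    rw [h2, add_sub_cancel_left]
    exact abs_weight_le h1
  -- Around the peak `m`, `u` is the last position before it and `d` the first after it with energy
  -- at most `l`. One step changes the energy by at most `W`, so both energies are within `W` of
  -- `l`.
  have hex : ∀ l ∈ Icc (L + W) (L + W + Q), ∃ u d : ℕ, u < m ∧ m < d ∧ d ≤ k ∧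
      (l - W ≤ (r u).2 ∧ (r u).2 ≤ l) ∧ (l - W ≤ (r d).2 ∧ (r d).2 ≤ l) ∧
      ∀ i, u < i → i < d → l < (r i).2 := by
    intro l hl
    obtain ⟨hl1, hl2⟩ := mem_Icc.1 hl
    obtain ⟨u, hu, hul, hui⟩ := exists_last_le (e := fun i => (r i).2) (l := l) (m := m)
      (by omega) (by omega)
    obtain ⟨d, hd, hdk, hdl, hdi⟩ := exists_first_le (e := fun i => (r i).2) (l := l) (m := m) hmk
      (by omega) (by omega)
    have h1 := abs_le.1 (hstep u (by omega))
    have h2 := hui (u + 1) (by omega) (by omega)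
    obtain ⟨d, rfl⟩ := Nat.exists_eq_succ_of_ne_zero (show d ≠ 0 by omega)
    have h3 := abs_le.1 (hstep d (by omega))
    have h4 := hdi d (by omega) (by omega)
    simp only [Nat.succ_eq_add_one] at *
    refine ⟨u, d + 1, hu, hd, hdk, ⟨by omega, hul⟩, ⟨by omega, hdl⟩, fun i hi hi' => ?_⟩
    rcases Nat.lt_or_ge m i with h | h
    · exact hdi i h.le hi'
    · exact hui i hi h
  choose! u d hum hmd hdk hu hd hin using hex
  have hmaps : ∀ l ∈ Icc (L + W) (L + W + Q),
      (((r (u l)).1, l - (r (u l)).2), ((r (d l)).1, l - (r (d l)).2)) ∈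
        ((univ : Finset S) ×ˢ Icc 0 W) ×ˢ ((univ : Finset S) ×ˢ Icc 0 W) := by
    intro l hl
    have h1 := hu l hl
    have h2 := hd l hl
    simp only [mem_product, mem_univ, true_and, mem_Icc]
    omega
  -- There are `Q + 1` levels but only `Q` possible pairs of states with offsets. For two levels
  -- that agree, the walk between `u b` and `d b`, lowered by `b - a`, fits exactly between `u a`
  -- and `d a`.
  obtain ⟨a, ha, b, hb, hab, hEq⟩ : ∃ a ∈ Icc (L + W) (L + W + Q), ∃ b ∈ Icc (L + W) (L + W + Q),
      a < b ∧ (((r (u a)).1, a - (r (u a)).2), ((r (d a)).1, a - (r (d a)).2)) =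
        (((r (u b)).1, b - (r (u b)).2), ((r (d b)).1, b - (r (d b)).2)) := by
    obtain ⟨a, ha, b, hb, hne, hEq⟩ := exists_ne_map_eq_of_card_lt_of_maps_to (by
      simp only [card_product, card_univ, Int.card_Icc]
      have h1 : (L + W + Q + 1 - (L + W)).toNat = Q + 1 := by omega
      have h2 : (W + 1 - 0).toNat = G.maxWeight + 1 := by omega
      rw [h1, h2, hQ]
      apply Nat.lt_succ_of_le
      apply le_of_eq
      ring) hmaps
    rcases lt_or_gt_of_ne hne with h | h
    · exact ⟨a, ha, b, hb, h, hEq⟩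
    · exact ⟨b, hb, a, ha, h, hEq.symm⟩
  simp only [Prod.mk.injEq] at hEq
  obtain ⟨⟨hus, hue⟩, hds, hde⟩ := hEq
  have hua := hu a ha
  have hub := hu b hb
  have hda := hd a ha
  have hdb := hd b hb
  have hdka := hdk a ha
  have hdkb := hdk b hb
  have huma := hum a ha
  have humb := hum b hb
  have hmda := hmd a ha
  have hmdb := hmd b hb
  have hLa := (mem_Icc.1 ha).1
  have huab : u a < u b := by
    by_contra hcon
    rcases (not_lt.1 hcon).eq_or_lt with h | h
    · rw [h] at hue
      omega
    · have := hin b hb (u a) h (by omega)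
      omega
  have hdab : d b < d a := by
    by_contra hcon
    rcases (not_lt.1 hcon).eq_or_lt with h | h
    · rw [h] at hde
      omega
    · have := hin b hb (d a) (by omega) h
      omega
  have w₁ : HasWalk (G.ConfigStep (0 ≤ ·)) (fun c _ => τ - (c.2 : ℝ)) (r 0) (r (u a)) _ _ :=
    HasWalk.of_segment r (m := 0) (n := u a) (by omega) fun i _ hi => hr i (by omega)
  have w₃ : HasWalk (G.ConfigStep (0 ≤ ·)) (fun c _ => τ - (c.2 : ℝ)) (r (d a)) (r k) _ _ :=
    HasWalk.of_segment r (m := d a) (n := k) hdka fun i _ hi => hr i hi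
  -- Inside, the energy exceeds `b`, hence `a` after the shift; at the ends it becomes that of `u a`
  -- or `d a`, at least `a - W ≥ L`.
  have hshift : ∀ i, u b ≤ i → i ≤ d b → 0 ≤ (r i).2 - (b - a) := by
    intro i h1 h2
    rcases h1.eq_or_lt with rfl | h1
    · omega
    rcases h2.eq_or_lt with rfl | h2
    · omega
    have := hin b hb i h1 h2
    omega
  have w₂ : HasWalk (G.ConfigStep (0 ≤ ·)) (fun c _ => τ - (c.2 : ℝ))
      ((r (u b)).1, (r (u b)).2 - (b - a)) ((r (d b)).1, (r (d b)).2 - (b - a)) _ _ :=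
    HasWalk.of_segment (fun i => ((r i).1, (r i).2 - (b - a))) (m := u b) (n := d b) (by omega) (by
      intro i h1 h2
      obtain ⟨h3, h4, -, -⟩ := hr i (by omega)
      exact ⟨h3, by simp only [h4]; ring, hshift i h1 h2.le, hshift (i + 1) (by omega) h2⟩)
  rw [← hus, ← hds, show (r (u b)).2 - (b - a) = (r (u a)).2 by omega,
    show (r (d b)).2 - (b - a) = (r (d a)).2 by omega] at w₂
  refine ⟨_, ?_, _, ?_, (w₁.trans w₂).trans w₃⟩
  · omega
  · have hab' : (a : ℝ) < b := by exact_mod_cast hab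
    -- Removed positions have energy at least `L ≥ τ`, so they contribute nothing positive; lowering
    -- the middle only raises `τ` minus energy.
    have e₁ : ∑ i ∈ Ico (u a) (u b), (τ - ((r i).2 : ℝ)) ≤ 0 := by
      refine sum_nonpos fun i hi => ?_
      have hi := mem_Ico.1 hi
      have : L ≤ (r i).2 := by
        rcases hi.1.eq_or_lt with h | h
        · rw [← h]; omega
        · have := hin a ha i h (by omega)
          omega
      have : (L : ℝ) ≤ (r i).2 := by exact_mod_cast this
      linarith
    have e₂ : ∑ i ∈ Ico (d b) (d a), (τ - ((r i).2 : ℝ)) ≤ 0 := by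
      refine sum_nonpos fun i hi => ?_
      have hi := mem_Ico.1 hi
      have := hin a ha i (by omega) hi.2
      have : L ≤ (r i).2 := by omega
      have : (L : ℝ) ≤ (r i).2 := by exact_mod_cast this
      linarith
    have e₃ : ∑ i ∈ Ico (u b) (d b), (τ - ((r i).2 : ℝ)) ≤
        ∑ i ∈ Ico (u b) (d b), (τ - (((r i).2 - (b - a) : ℤ) : ℝ)) := by
      refine sum_le_sum fun i _ => ?_
      push_cast
      linarith
    rw [range_eq_Ico]
    have s₁ := sum_Ico_consecutive (fun i => τ - ((r i).2 : ℝ)) (Nat.zero_le (u a))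
      (by omega : u a ≤ k)
    have s₂ := sum_Ico_consecutive (fun i => τ - ((r i).2 : ℝ)) huab.le (by omega : u b ≤ k)
    have s₃ := sum_Ico_consecutive (fun i => τ - ((r i).2 : ℝ)) (by omega : u b ≤ d b) hdkb
    have s₄ := sum_Ico_consecutive (fun i => τ - ((r i).2 : ℝ)) hdab.le hdka
    linarith

/-- Walks with nonnegative energy between configurations of low energy can be replaced by walks of
bounded energy, without lowering the cost. -/
theorem Game.exists_bounded_walk [Fintype S] {L B : ℤ} {τ : ℝ} (hL : 0 ≤ L) (hτ : τ ≤ L)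
    (hB : B = L + G.maxWeight + Fintype.card S ^ 2 * (G.maxWeight + 1) ^ 2) {c c' : S × ℤ}
    (hc : c.2 ≤ L) (hc' : c'.2 ≤ L) {k : ℕ} {x : ℝ}
    (h : HasWalk (G.ConfigStep (0 ≤ ·)) (fun c _ => τ - c.2) c c' k x) :
    ∃ k' x', x ≤ x' ∧
      HasWalk (G.ConfigStep fun e => 0 ≤ e ∧ e ≤ B) (fun c _ => τ - c.2) c c' k' x' := by
  induction k using Nat.strong_induction_on generalizing x with
  | _ k ih =>
    obtain ⟨r, rfl, rfl, hr, rfl⟩ := h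
    by_cases hb : ∀ m ≤ k, (r m).2 ≤ B
    · refine ⟨k, _, le_rfl, r, rfl, rfl, fun i hi => ?_, rfl⟩
      obtain ⟨h1, h2, h3, h4⟩ := hr i hi
      exact ⟨h1, h2, ⟨h3, hb i hi.le⟩, h4, hb (i + 1) hi⟩
    · push Not at hb
      obtain ⟨m, hmk, hm⟩ := hb
      obtain ⟨k', hk', x', hx', hw⟩ := exists_shorter_walk hL hτ hr hc hc' hmk (hB ▸ hm)
      obtain ⟨k'', x'', hx'', hw'⟩ := ih k' hk' hw
      exact ⟨k'', x'', hx'.trans hx'', hw'⟩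

/-- A play of average-energy less than `τ` contains a closed walk of configurations of low energy
and mean energy less than `τ`. -/
theorem Game.Play.exists_low_closed_segment [Fintype S] (ρ : G.Play) (hpos : ∀ n, 0 ≤ ρ.energy n)
    {t τ : ℝ} (htτ : t < τ) (ht : ρ.avgEnergy ≤ (t : EReal)) {L : ℤ} (hτ : τ ≤ L) :
    ∃ i j, i < j ∧ ρ.state i = ρ.state j ∧ ρ.energy i = ρ.energy j ∧ ρ.energy i ≤ L ∧
      0 < ∑ n ∈ Ico i j, (τ - (ρ.energy n : ℝ)) := by
  by_contra hcon
  push Not at hcon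
  obtain ⟨M, hM⟩ := exists_lower_bound_of_visits (fun n => (ρ.state n, ρ.energy n))
    (fun n => ∑ i ∈ range n, ((ρ.energy i : ℝ) - τ)) (A := Set.univ ×ˢ Set.Icc 0 L)
    (Set.finite_univ.prod (Set.finite_Icc 0 L)) (by
      intro i j hij hEq hlow
      obtain ⟨h1, h2⟩ := Prod.mk.inj hEq
      have h3 := hcon i j hij h1 h2 hlow.2.2
      rw [← sum_range_add_sum_Ico _ hij.le]
      simp only [sum_sub_distrib] at h3 ⊢
      linarith)
  -- Above `L` the sum increases; a step at low energy loses at most `τ` from a value that is at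
  -- least `M`.
  have hlow : ∀ n, min 0 (M - max 0 τ) ≤ ∑ i ∈ range n, ((ρ.energy i : ℝ) - τ) := by
    intro n
    induction n with
    | zero => simp
    | succ n ih =>
      rw [sum_range_succ]
      have hn : (0 : ℝ) ≤ ρ.energy n := by exact_mod_cast hpos n
      rcases le_or_gt (ρ.energy n) L with h | h
      · have h1 := hM n ⟨Set.mem_univ _, hpos n, h⟩
        have h2 := min_le_right 0 (M - max 0 τ)
        have h3 := le_max_right 0 τ
        linarith
      · have : (L : ℝ) < ρ.energy n := by exact_mod_cast h
        linarith
  obtain ⟨n, hn⟩ := ρ.exists_sum_lt htτ ht (min 0 (M - max 0 τ))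
  exact absurd (hlow n) (not_le.2 hn)

/-- In a game without states of player 2, a winning strategy can be chosen with memory at most the
number of configurations of bounded energy. -/
theorem Game.exists_winsOne_hasMemory [Fintype S] (h2 : G.states .two = ∅) {s₀ : S} {t : ℚ}
    {ρ : G.Play} (hρ0 : ρ.state 0 = s₀) (hρ : ρ ∈ G.AEL t) :
    ∃ (σ : G.Strategy .one) (k : ℕ), WinsOne s₀ (G.AEL t) σ ∧ σ.HasMemory k ∧
      k ≤ Fintype.card S *
        (⌈t⌉₊ + 1 + G.maxWeight + Fintype.card S ^ 2 * (G.maxWeight + 1) ^ 2 + 1) := by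
  obtain ⟨hpos, havg⟩ := hρ
  replace hpos : ∀ n, 0 ≤ ρ.energy n := fun n => by simpa using hpos n
  set B : ℕ := ⌈t⌉₊ + 1 + G.maxWeight + Fintype.card S ^ 2 * (G.maxWeight + 1) ^ 2 with hB
  set N : ℕ := Fintype.card S * (B + 1) with hN
  have hN0 : 0 < N := Nat.mul_pos (Fintype.card_pos_iff.2 ⟨s₀⟩) (Nat.succ_pos _)
  set L : ℤ := ⌈t⌉₊ + 1 with hL
  -- Over at most `N` positions this slack amounts to at most `1 / t.den`, the granularity of the
  -- comparison of an integer sum with a multiple of `t`.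
  set τ : ℝ := t + 1 / (t.den * N) with hτ
  have hden : (1 : ℝ) ≤ t.den := by exact_mod_cast t.den_pos
  have hN1 : (1 : ℝ) ≤ N := by exact_mod_cast hN0
  have htτ : (t : ℝ) < τ := by
    rw [hτ, lt_add_iff_pos_right]
    positivity
  have hτL : τ ≤ L := by
    have h1 : (t : ℝ) ≤ ⌈t⌉₊ := by exact_mod_cast Nat.le_ceil t
    have h2 : 1 / ((t.den : ℝ) * N) ≤ 1 := by
      rw [div_le_one (by positivity)]
      nlinarith
    rw [hτ, hL]
    push_cast
    linarith
  obtain ⟨i, j, hij, hs, he, hlow, hsum⟩ := ρ.exists_low_closed_segment hpos htτ havg hτL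
  let y : ℕ → S × ℤ := fun n => (ρ.state n, ρ.energy n)
  have hy : ∀ n, G.ConfigStep (0 ≤ ·) (y n) (y (n + 1)) := fun n =>
    ⟨ρ.step n, ρ.energy_succ n, hpos n, hpos (n + 1)⟩
  have hBL : (B : ℤ) = L + G.maxWeight + Fintype.card S ^ 2 * (G.maxWeight + 1) ^ 2 := by
    rw [hB, hL]
    push_cast
    ring
  have hL0 : 0 ≤ L := by omega
  obtain ⟨k₁, x₁, -, w₁⟩ := exists_bounded_walk hL0 hτL hBL
    (by simp only [y, ρ.energy_zero]; exact hL0) hlow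
    (HasWalk.of_segment y (g := fun c _ => τ - (c.2 : ℝ)) (Nat.zero_le i) fun n _ _ => hy n)
  have hyij : y j = y i := by simp only [y, hs, he]
  have wc := HasWalk.of_segment y (g := fun c _ => τ - (c.2 : ℝ)) hij.le fun n _ _ => hy n
  rw [hyij] at wc
  obtain ⟨k₂, x₂, hx₂, w₂⟩ := exists_bounded_walk hL0 hτL hBL hlow hlow wc
  obtain ⟨r, p, q, hq, hr0, hr, hclose, hinj, hcyc⟩ :=
    exists_simple_lasso w₁ w₂ (hsum.trans_le hx₂)
  have hcard : p + q ≤ N := by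
    have hmaps : ∀ i ∈ range (p + q), r i ∈ (univ : Finset S) ×ˢ Icc (0 : ℤ) B := by
      intro i hi
      obtain ⟨-, -, h, -⟩ := hr i (mem_range.1 hi)
      simpa using h
    have := card_le_card_of_injOn r hmaps (by simpa using hinj)
    simpa [hN, Int.card_Icc] using this
  obtain ⟨σ, hσ, hmem⟩ := exists_winsOne_of_lasso h2 (s₀ := s₀) (t := t) hq
    (by rw [hr0]; simp only [y, hρ0, ρ.energy_zero]) hclose (fun i hi => (hr i hi).1)
    (fun i hi => (hr i hi).2.1) (fun i hi => (hr i hi).2.2.1.1) (by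
      set E : ℤ := ∑ i ∈ Ico p (p + q), (r i).2 with hE
      have hEr : (E : ℝ) = ∑ i ∈ Ico p (p + q), ((r i).2 : ℝ) := by rw [hE]; push_cast; rfl
      simp only [sum_sub_distrib, sum_const, Nat.card_Ico, Nat.add_sub_cancel_left, nsmul_eq_mul,
        ← hEr] at hcyc ⊢
      have hqN : (q : ℝ) ≤ N := by exact_mod_cast (by omega : q ≤ N)
      have htden : (t : ℝ) * t.den = t.num := by exact_mod_cast Rat.mul_den_eq_num t
      have h1 : (E : ℝ) * t.den < q * t.num + 1 := by
        have h3 : (E : ℝ) * t.den < q * τ * t.den := by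
          have : (E : ℝ) < q * τ := by linarith
          exact mul_lt_mul_of_pos_right this (by linarith)
        have h4 : q * τ * t.den = q * t.num + q / N := by
          rw [← htden, hτ]
          field_simp
        have h5 : (q : ℝ) / N ≤ 1 := (div_le_one (by linarith)).2 hqN
        linarith
      -- Integrality turns the strict bound with slack into the exact bound.
      have h2 : E * t.den < q * t.num + 1 := by exact_mod_cast h1
      have h3 : (E : ℝ) * t.den ≤ q * t.num := by exact_mod_cast Int.lt_add_one_iff.1 h2
      rw [← htden, ← mul_assoc] at h3
      have := le_of_mul_le_mul_right h3 (by linarith)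
      linarith)
  exact ⟨σ, p + q, hσ, hmem, hcard⟩

end BoundedEnergy

/-! ### A game that requires counting up to `U`. -/

section LowerBound

open Game

theorem Game.Play.lt_avgEnergy_of_eventually {S : Type*} {G : Game S} (ρ : G.Play) {t : ℝ} {p : ℕ}
    (h : ∀ n, p ≤ n → t + 1 ≤ ρ.energy n) : (t : EReal) < ρ.avgEnergy := by
  obtain ⟨D, hD⟩ := exists_linear_lower_bound (p := p) (q := 1) (δ := 1)
    (f := fun n => ∑ i ∈ range n, ((ρ.energy i : ℝ) - t)) zero_le_one one_pos (by
      intro n hn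
      rw [sum_range_succ]
      linarith [h n hn])
  exact ρ.lt_avgEnergy (c := 1 / (1 : ℕ)) (by norm_num) hD

/-- The game with two states `0` and `1` in which the cycle through both gains `1` and the loop at
`0` loses `U`. -/
def counterGame (U : ℕ) : Game (Fin 2) where
  owner _ := .one
  edge s s' := s = 0 ∨ s' = 0
  weight s s' := if s = 0 then (if s' = 0 then -U else 1) else 0
  total _ := ⟨0, Or.inr rfl⟩

theorem counterGame_states_two (U : ℕ) : (counterGame U).states .two = ∅ := by
  simp [Game.states, counterGame]

theorem counterGame_maxWeight {U : ℕ} (hU : 1 ≤ U) : (counterGame U).maxWeight = U := by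
  classical
  refine le_antisymm (Finset.sup_le fun e _ => ?_) ?_
  · simp only [counterGame]
    split_ifs <;> simp [hU]
  · have := abs_weight_le (G := counterGame U) (s := 0) (s' := 0) (Or.inl rfl)
    simpa [counterGame] using this

theorem sum_range_half (U : ℕ) : ∑ i ∈ range (2 * U + 1), ((i + 1) / 2) = U * (U + 1) := by
  induction U with
  | zero => simp
  | succ U ih =>
    rw [show 2 * (U + 1) + 1 = 2 * U + 1 + 1 + 1 by ring, sum_range_succ, sum_range_succ, ih,
      show (2 * U + 1 + 1) / 2 = U + 1 by omega, show (2 * U + 1 + 1 + 1) / 2 = U + 1 by omega]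
    ring

/-- `U` rounds through both states followed by one loop visit the energies `0, 1, 1, …, U, U`, whose
mean is exactly the threshold. -/
theorem counterGame_exists_winsOne (U : ℕ) :
    ∃ σ : (counterGame U).Strategy .one,
      WinsOne 0 ((counterGame U).AEL ((U * (U + 1) : ℚ) / (2 * U + 1))) σ := by
  let r : ℕ → Fin 2 × ℤ := fun i =>
    if i < 2 * U + 1 then (if i % 2 = 0 then 0 else 1, ((i + 1) / 2 : ℕ)) else (0, 0)
  have hr : ∀ i < 2 * U + 1, r i = (if i % 2 = 0 then 0 else 1, (((i + 1) / 2 : ℕ) : ℤ)) :=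
    fun i hi => if_pos hi
  have hlast : r (2 * U + 1) = (0, 0) := if_neg (by omega)
  have hstep : ∀ i < 2 * U + 1, (counterGame U).edge (r i).1 (r (i + 1)).1 ∧
      (r (i + 1)).2 = (r i).2 + (counterGame U).weight (r i).1 (r (i + 1)).1 := by
    intro i hi
    rcases Nat.lt_or_ge (i + 1) (2 * U + 1) with h | h
    · rw [hr i hi, hr (i + 1) h]
      rcases Nat.mod_two_eq_zero_or_one i with h0 | h0
      · have h1 : (i + 1) % 2 = 1 := by omega
        have h2 : ((i + 1 + 1) / 2 : ℕ) = (i + 1) / 2 + 1 := by omega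
        simp [counterGame, h0, h1, h2]
      · have h1 : (i + 1) % 2 = 0 := by omega
        have h2 : ((i + 1 + 1) / 2 : ℕ) = (i + 1) / 2 := by omega
        simp [counterGame, h0, h1, h2]
    · obtain rfl : i = 2 * U := by omega
      rw [hr (2 * U) hi, hlast]
      have h2 : (2 * U + 1) / 2 = U := by omega
      simp [counterGame, h2]
  obtain ⟨σ, hσ, -⟩ := exists_winsOne_of_lasso (G := counterGame U) (counterGame_states_two U)
    (s₀ := 0) (t := (U * (U + 1) : ℚ) / (2 * U + 1)) (r := r) (p := 0) (q := 2 * U + 1) (by omega)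
    (by rw [hr 0 (by omega)]; simp) (by rw [zero_add, hlast, hr 0 (by omega)]; simp)
    (fun i hi => (hstep i (by omega)).1) (fun i hi => (hstep i (by omega)).2)
    (fun i hi => by rw [hr i (by omega)]; positivity) (by
      have h1 : ∑ i ∈ Ico 0 (0 + (2 * U + 1)), ((r i).2 : ℝ) = U * (U + 1) := by
        rw [zero_add, ← range_eq_Ico]
        have := congrArg (Nat.cast (R := ℝ)) (sum_range_half U)
        push_cast at this
        rw [← this]
        refine sum_congr rfl fun i hi => ?_
        rw [hr i (mem_range.1 hi)]
        exact Int.cast_natCast _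
      rw [sum_sub_distrib, h1]
      simp only [sum_const, Nat.card_Ico, nsmul_eq_mul, zero_add, Nat.sub_zero]
      push_cast
      have : (2 * (U : ℝ) + 1) ≠ 0 := by positivity
      rw [mul_div_cancel₀ _ this, sub_self])
  exact ⟨σ, hσ⟩

theorem counterGame_state_energy {U : ℕ} (ρ : (counterGame U).Play) (h0 : ρ.state 0 = 0) {N : ℕ}
    (hN : ∀ j < N, ρ.state (2 * j + 1) ≠ 0) : ρ.state (2 * N) = 0 ∧ ρ.energy (2 * N) = N := by
  induction N with
  | zero => exact ⟨h0, by simp [ρ.energy_zero]⟩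
  | succ N ih =>
    obtain ⟨h1, h2⟩ := ih fun j hj => hN j (by omega)
    have h3 := hN N (by omega)
    have h4 : ρ.state (2 * N + 1 + 1) = 0 := (ρ.step (2 * N + 1)).resolve_left h3
    refine ⟨h4, ?_⟩
    rw [show 2 * (N + 1) = 2 * N + 1 + 1 by ring, ρ.energy_succ, ρ.energy_succ, h2]
    simp [counterGame, h1, h3]

/-- Without the loop the energy diverges, so the loop is taken, and its first use after `N` rounds
needs energy at least `U`, hence `N ≥ U`. The memories at the starts of rounds `0, …, N` must all
differ, or the loop would come earlier. -/
theorem counterGame_memory_le {U : ℕ} {t : ℚ} {σ : (counterGame U).Strategy .one}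
    (hσ : WinsOne 0 ((counterGame U).AEL t) σ) {k : ℕ} (hk : σ.HasMemory k) : U + 1 ≤ k := by
  classical
  obtain ⟨A, hA⟩ := hk
  obtain ⟨σ₂⟩ := nonempty_strategy_of_states_eq_empty (counterGame_states_two U) 0
  have hwin := hσ σ₂
  obtain ⟨h0, hcons, -⟩ := outcome_spec 0 σ σ₂
  generalize outcome 0 σ σ₂ = ρ at hwin h0 hcons
  obtain ⟨hpos, havg⟩ := hwin
  have hmove : ∀ n, ρ.state (n + 1) = A.next (A.memory ρ.state n) (ρ.state n) := fun n =>
    (hcons n rfl).symm.trans (hA ρ n rfl)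
  have hex : ∃ n, ρ.state (2 * n + 1) = 0 := by
    by_contra hcon
    push Not at hcon
    refine absurd havg (not_le.2 (ρ.lt_avgEnergy_of_eventually (p := 2 * (⌈t⌉₊ + 1)) fun n hn => ?_))
    have hle : ((n / 2 : ℕ) : ℤ) ≤ ρ.energy n := by
      obtain ⟨h1, h2⟩ := counterGame_state_energy ρ h0 (N := n / 2) fun j _ => hcon j
      rcases Nat.mod_two_eq_zero_or_one n with h | h
      · rw [show 2 * (n / 2) = n by omega] at h2
        exact h2.ge
      · obtain ⟨m, rfl⟩ : ∃ m, n = 2 * m + 1 := ⟨n / 2, by omega⟩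
        rw [show (2 * m + 1) / 2 = m by omega] at h1 h2 ⊢
        rw [ρ.energy_succ, h2]
        simp [counterGame, h1, hcon m]
    have h1 : (⌈t⌉₊ + 1 : ℕ) ≤ n / 2 := by omega
    have h2 : ((⌈t⌉₊ + 1 : ℕ) : ℤ) ≤ ρ.energy n := le_trans (by exact_mod_cast h1) hle
    have h3 : (t : ℝ) ≤ ⌈t⌉₊ := by exact_mod_cast Nat.le_ceil t
    have h4 : (((⌈t⌉₊ + 1 : ℕ) : ℤ) : ℝ) ≤ ρ.energy n := by exact_mod_cast h2
    push_cast at h4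
    linarith
  let N := Nat.find hex
  have hN : ρ.state (2 * N + 1) = 0 := Nat.find_spec hex
  have hNmin : ∀ j < N, ρ.state (2 * j + 1) ≠ 0 := fun j hj => Nat.find_min hex hj
  have hst : ∀ j ≤ N, ρ.state (2 * j) = 0 := fun j hj =>
    (counterGame_state_energy ρ h0 fun i hi => hNmin i (by omega)).1
  have hone : ∀ j < N, ρ.state (2 * j + 1) = 1 := fun j hj => by
    have := hNmin j hj
    omega
  have hUN : U ≤ N := by
    obtain ⟨h1, h2⟩ := counterGame_state_energy ρ h0 hNmin
    have h3 := hpos (2 * N + 1)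
    rw [ρ.energy_succ, h2] at h3
    simp [counterGame, h1, hN] at h3
    exact h3
  have hinj : Set.InjOn (fun j => A.memory ρ.state (2 * j)) (Set.Iic N) := by
    have key : ∀ i j, i < j → j ≤ N → A.memory ρ.state (2 * i) ≠ A.memory ρ.state (2 * j) := by
      intro i j hij hj hEq
      -- Both stretches read the same alternating states, so equal memories stay equal until the
      -- later stretch reaches the loop.
      have hshift : ∀ d, j + d ≤ N →
          A.memory ρ.state (2 * (i + d)) = A.memory ρ.state (2 * (j + d)) := by
        intro d
        induction d with
        | zero => exact fun _ => hEq
        | succ d ih =>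
          intro hd
          rw [show 2 * (i + (d + 1)) = 2 * (i + d) + 1 + 1 by ring,
            show 2 * (j + (d + 1)) = 2 * (j + d) + 1 + 1 by ring, A.memory_succ, A.memory_succ,
            A.memory_succ, A.memory_succ, ih (by omega), hst _ (by omega), hst _ (by omega),
            hone _ (by omega), hone _ (by omega)]
      have h1 := hshift (N - j) (by omega)
      rw [show j + (N - j) = N by omega] at h1
      have h2 := hmove (2 * (i + (N - j)))
      have h3 := hmove (2 * N)
      rw [h1, hst _ (by omega), hone _ (by omega)] at h2
      rw [hst _ le_rfl, hN] at h3
      exact absurd (h2.trans h3.symm) one_ne_zero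
    intro i hi j hj hEq
    rcases lt_trichotomy i j with h | h | h
    · exact absurd hEq (key i j h hj)
    · exact h
    · exact absurd hEq.symm (key j i h hi)
  have hcard := card_le_card_of_injOn (s := range (N + 1)) (t := univ)
    (fun j => A.memory ρ.state (2 * j)) (fun _ _ => mem_univ _) (by
      intro i hi j hj
      exact hinj (Nat.lt_succ_iff.1 (by simpa using hi)) (Nat.lt_succ_iff.1 (by simpa using hj)))
  simp only [card_range, card_univ, Fintype.card_fin] at hcard
  omega

end LowerBound

/-! ### Player 2: memoryless strategies. -/

section Memoryless

variable {S : Type*} {G : Game S}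

open Game

/-- If all plays that follow the successor function `f` violate the objective, player 2 wins by a
memoryless strategy. -/
theorem Game.exists_winsTwo_memoryless (h1 : G.states .one = ∅) {s₀ : S} {Obj : Set G.Play}
    {f : S → S} (hf : ∀ s, G.edge s (f s))
    (h : ∀ ρ : G.Play, ρ.state 0 = s₀ → (∀ n, ρ.state (n + 1) = f (ρ.state n)) → ρ ∉ Obj) :
    ∃ σ : G.Strategy .two, WinsTwo s₀ Obj σ ∧ σ.Memoryless := by
  have hlast : ∀ (ρ : G.Play) n, (ρ.pref n).getLast?.getD s₀ = ρ.state n := fun ρ n => by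
    simp [ρ.pref_eq_append]
  refine ⟨⟨fun l => f (l.getLast?.getD s₀), fun ρ n _ => ?_⟩, fun σ₁ => ?_,
    f, fun ρ n _ => congrArg f (hlast ρ n)⟩
  · rw [hlast]
    exact hf _
  · obtain ⟨h0, -, hcons⟩ := outcome_spec s₀ σ₁ ⟨fun l => f (l.getLast?.getD s₀), _⟩
    refine h _ h0 fun n => ?_
    rw [← hcons n (owner_eq_two h1 _)]
    exact congrArg f (hlast _ n)

/-- A path without repetitions is followed by a successor function. -/
theorem Game.exists_successor_of_injOn {r : ℕ → S} {K : ℕ} (hr : ∀ i < K, G.edge (r i) (r (i + 1)))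
    (hinj : Set.InjOn r (Set.Iio K)) :
    ∃ f : S → S, (∀ s, G.edge s (f s)) ∧ ∀ i < K, f (r i) = r (i + 1) := by
  classical
  have hex : ∀ s, ∃ s', G.edge s s' ∧ ∀ i < K, r i = s → s' = r (i + 1) := by
    intro s
    by_cases hs : ∃ i < K, r i = s
    · obtain ⟨i, hi, rfl⟩ := hs
      exact ⟨r (i + 1), hr i hi, fun j hj hEq => by rw [hinj hj hi hEq]⟩
    · obtain ⟨s', hs'⟩ := G.total s
      exact ⟨s', hs', fun i hi hEq => absurd ⟨i, hi, hEq⟩ hs⟩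
  choose f hf hf' using hex
  exact ⟨f, hf, fun i hi => hf' (r i) i hi rfl⟩

/-- A simple lasso along which every play violates the objective yields a memoryless winning
strategy of player 2. -/
theorem Game.exists_winsTwo_of_lasso (h1 : G.states .one = ∅) {Obj : Set G.Play} {r : ℕ → S}
    {p q : ℕ} (hq : 0 < q) (hr : ∀ i < p + q, G.edge (r i) (r (i + 1))) (hclose : r (p + q) = r p)
    (hinj : Set.InjOn r (Set.Iio (p + q)))
    (h : ∀ ρ : G.Play, (∀ n, ρ.state n = r (lassoPos p q n)) →
      (∀ n, ρ.state (n + 1) = r (lassoPos p q n + 1)) → ρ ∉ Obj) :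
    ∃ σ : G.Strategy .two, WinsTwo (r 0) Obj σ ∧ σ.Memoryless := by
  obtain ⟨f, hf, hfr⟩ := exists_successor_of_injOn hr hinj
  refine exists_winsTwo_memoryless h1 hf fun ρ h0 hρ => ?_
  have hstate : ∀ n, ρ.state n = r (lassoPos p q n) := by
    intro n
    induction n with
    | zero => exact h0
    | succ n ih =>
      rw [hρ, ih, hfr _ (lassoPos_lt hq n), lassoPos_succ,
        lasso_apply_succ hclose (lassoPos_lt hq n)]
  exact h ρ hstate fun n => by rw [hρ, hstate, hfr _ (lassoPos_lt hq n)]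

theorem Game.Play.energy_lasso_add {r : ℕ → S} {p q : ℕ} (hq : 0 < q) (ρ : G.Play)
    (hs : ∀ n, ρ.state n = r (lassoPos p q n))
    (hs' : ∀ n, ρ.state (n + 1) = r (lassoPos p q n + 1)) {n : ℕ} (hn : p ≤ n) :
    (ρ.energy (n + q) : ℝ) =
      ρ.energy n + ∑ i ∈ Ico p (p + q), (G.weight (r i) (r (i + 1)) : ℝ) := by
  have h : ∀ n, (ρ.energy n : ℝ) =
      ∑ i ∈ range n, (G.weight (r (lassoPos p q i)) (r (lassoPos p q i + 1)) : ℝ) := by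
    intro n
    simp only [Play.energy]
    push_cast
    exact sum_congr rfl fun i _ => by rw [hs', hs]
  rw [h, h, sum_lasso_add hq (fun i => (G.weight (r i) (r (i + 1)) : ℝ)) hn]

/-- A linear function with positive slope is eventually large. -/
theorem exists_forall_le_of_linear {f : ℕ → ℝ} {c D : ℝ} (hc : 0 < c)
    (h : ∀ n : ℕ, c * n - D ≤ f n) (x : ℝ) : ∃ p, ∀ n, p ≤ n → x ≤ f n := by
  obtain ⟨p, hp⟩ := exists_nat_ge ((x + D) / c)
  refine ⟨p, fun n hn => ?_⟩
  have h1 : (p : ℝ) ≤ n := by exact_mod_cast hn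
  have h2 := (div_le_iff₀' hc).1 (hp.trans h1)
  linarith [h n]

/-- Costs are negated weights. Repeating a simple negative cycle drives the energy below zero. -/
theorem Game.exists_winsTwo_of_negative_cycle (h1 : G.states .one = ∅) {s₀ x : S} {t : ℚ} {j k : ℕ}
    {d e : ℝ} (hpre : HasWalk G.edge (fun s s' => -(G.weight s s' : ℝ)) s₀ x j d)
    (hcyc : HasWalk G.edge (fun s s' => -(G.weight s s' : ℝ)) x x k e) (he : 0 < e) :
    ∃ σ : G.Strategy .two, WinsTwo s₀ (G.AEL t) σ ∧ σ.Memoryless := by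
  obtain ⟨r, p, q, hq, rfl, hr, hclose, hinj, hsum⟩ := exists_simple_lasso hpre hcyc he
  refine exists_winsTwo_of_lasso h1 hq hr hclose hinj fun ρ hs hs' hρ => ?_
  obtain ⟨D, hD⟩ := exists_linear_lower_bound (p := p) (f := fun n => -(ρ.energy n : ℝ)) hsum.le hq
    (fun n hn => by
      rw [ρ.energy_lasso_add hq hs hs' hn, sum_neg_distrib]
      linarith)
  obtain ⟨n, hn⟩ := exists_forall_le_of_linear (div_pos hsum (by exact_mod_cast hq)) hD 1
  have h2 : (0 : ℤ) ≤ ρ.energy n := by simpa using hρ.1 n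
  have h3 : (0 : ℝ) ≤ ρ.energy n := by exact_mod_cast h2
  have := hn n le_rfl
  linarith

/-- Repeating a simple positive cycle drives the energy, and with it the average, above every bound.
-/
theorem Game.exists_winsTwo_of_positive_cycle (h1 : G.states .one = ∅) {s₀ x : S} {t : ℚ} {j k : ℕ}
    {d e : ℝ} (hpre : HasWalk G.edge (fun s s' => (G.weight s s' : ℝ)) s₀ x j d)
    (hcyc : HasWalk G.edge (fun s s' => (G.weight s s' : ℝ)) x x k e) (he : 0 < e) :
    ∃ σ : G.Strategy .two, WinsTwo s₀ (G.AEL t) σ ∧ σ.Memoryless := by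
  obtain ⟨r, p, q, hq, rfl, hr, hclose, hinj, hsum⟩ := exists_simple_lasso hpre hcyc he
  refine exists_winsTwo_of_lasso h1 hq hr hclose hinj fun ρ hs hs' hρ => ?_
  obtain ⟨D, hD⟩ := exists_linear_lower_bound (p := p) (f := fun n => (ρ.energy n : ℝ)) hsum.le hq
    (fun n hn => (ρ.energy_lasso_add hq hs hs' hn).ge)
  obtain ⟨n, hn⟩ := exists_forall_le_of_linear (div_pos hsum (by exact_mod_cast hq)) hD (t + 1)
  exact absurd hρ.2 (not_le.2 (ρ.lt_avgEnergy_of_eventually hn))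

/-- If a path reaches negative energy, player 2 has a memoryless strategy. -/
theorem Game.exists_winsTwo_of_negative_walk (h1 : G.states .one = ∅) {s₀ x : S} {t : ℚ} {k : ℕ}
    {e : ℝ} (hw : HasWalk G.edge (fun s s' => -(G.weight s s' : ℝ)) s₀ x k e) (he : 0 < e) :
    ∃ σ : G.Strategy .two, WinsTwo s₀ (G.AEL t) σ ∧ σ.Memoryless := by
  classical
  by_cases hcyc : ∃ y j d l e, HasWalk G.edge (fun s s' => -(G.weight s s' : ℝ)) s₀ y j d ∧
      HasWalk G.edge (fun s s' => -(G.weight s s' : ℝ)) y y l e ∧ 0 < e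
  · obtain ⟨y, j, d, l, e, hpre, hc, he⟩ := hcyc
    exact exists_winsTwo_of_negative_cycle h1 hpre hc he
  -- Without a reachable negative cycle, a shortest walk to negative energy repeats no state:
  -- cutting out a cycle would not raise the final energy.
  have hP : ∃ k x e, HasWalk G.edge (fun s s' => -(G.weight s s' : ℝ)) s₀ x k e ∧ 0 < e :=
    ⟨k, x, e, hw, he⟩
  obtain ⟨k, ⟨x, e, ⟨r, rfl, -, hr, rfl⟩, he⟩, hmin⟩ :
      ∃ k, (∃ x e, HasWalk G.edge (fun s s' => -(G.weight s s' : ℝ)) s₀ x k e ∧ 0 < e) ∧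
      ∀ k', (∃ x e, HasWalk G.edge (fun s s' => -(G.weight s s' : ℝ)) s₀ x k' e ∧ 0 < e) → k ≤ k' :=
    ⟨Nat.find hP, Nat.find_spec hP, fun _ h => Nat.find_min' hP h⟩
  have seg : ∀ m n, m ≤ n → n ≤ k → HasWalk G.edge (fun s s' => -(G.weight s s' : ℝ)) (r m) (r n)
      (n - m) (∑ i ∈ Ico m n, -(G.weight (r i) (r (i + 1)) : ℝ)) :=
    fun m n hmn hn => HasWalk.of_segment r hmn fun i _ hi => hr i (by omega)
  have key : ∀ m n, m < n → n ≤ k → r m ≠ r n := by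
    intro m n hmn hn hEq
    have w₁ := seg 0 m (by omega) (by omega)
    have w₂ := seg m n hmn.le hn
    have w₃ := seg n k hn le_rfl
    rw [← hEq] at w₂ w₃
    have hle : ∑ i ∈ Ico m n, -(G.weight (r i) (r (i + 1)) : ℝ) ≤ 0 := by
      by_contra hcon
      exact hcyc ⟨_, _, _, _, _, w₁, w₂, not_le.1 hcon⟩
    have s₁ := sum_Ico_consecutive (fun i => -(G.weight (r i) (r (i + 1)) : ℝ)) (Nat.zero_le m)
      (by omega : m ≤ k)
    have s₂ := sum_Ico_consecutive (fun i => -(G.weight (r i) (r (i + 1)) : ℝ)) hmn.le hn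
    rw [range_eq_Ico] at he
    have := hmin _ ⟨_, _, w₁.trans w₃, by linarith⟩
    omega
  obtain ⟨f, hf, hfr⟩ := exists_successor_of_injOn hr (by
    intro m hm n hn hEq
    rcases lt_trichotomy m n with h | h | h
    · exact absurd hEq (key m n h (le_of_lt hn))
    · exact h
    · exact absurd hEq.symm (key n m h (le_of_lt hm)))
  refine exists_winsTwo_memoryless h1 hf fun ρ h0 hρ hmem => ?_
  have hstate : ∀ n ≤ k, ρ.state n = r n := by
    intro n
    induction n with
    | zero => exact fun _ => h0
    | succ n ih => exact fun hn => by rw [hρ, ih (by omega), hfr n hn]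
  have h2 : (0 : ℤ) ≤ ρ.energy k := by simpa using hmem.1 k
  have h3 : (0 : ℝ) ≤ ρ.energy k := by exact_mod_cast h2
  have h4 : (ρ.energy k : ℝ) = -∑ i ∈ range k, -(G.weight (r i) (r (i + 1)) : ℝ) := by
    rw [sum_neg_distrib, neg_neg, Play.energy]
    push_cast
    refine sum_congr rfl fun i hi => ?_
    have := mem_range.1 hi
    rw [hstate i (by omega), hstate (i + 1) (by omega)]
  linarith

/-- If the energy along a play is a function of the state and its average-energy exceeds `t`,
player 2 has a memoryless strategy. -/
theorem Game.exists_winsTwo_of_energy_eq [Finite S] (h1 : G.states .one = ∅) {t : ℚ} (ρ : G.Play)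
    (ε : S → ℤ) (hε : ∀ n, ρ.energy n = ε (ρ.state n)) (ht : ((t : ℝ) : EReal) < ρ.avgEnergy) :
    ∃ σ : G.Strategy .two, WinsTwo (ρ.state 0) (G.AEL t) σ ∧ σ.Memoryless := by
  obtain ⟨i, j, hij, hEq, hsum⟩ : ∃ i j, i < j ∧ ρ.state i = ρ.state j ∧
      0 < ∑ n ∈ Ico i j, ((ρ.energy n : ℝ) - t) := by
    by_contra hcon
    push Not at hcon
    obtain ⟨M, hM⟩ := exists_lower_bound_of_visits ρ.state
      (fun n => -∑ i ∈ range n, ((ρ.energy i : ℝ) - t)) Set.finite_univ (by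
        intro i j hij hEq _
        have := hcon i j hij hEq
        rw [← sum_range_add_sum_Ico _ hij.le]
        linarith)
    refine absurd (ρ.avgEnergy_le (t := t) (D := -M) fun n => ?_) (not_le.2 ht)
    have := hM n (Set.mem_univ _)
    linarith
  -- Only edges compatible with `ε` are kept, so that along any path from the initial state the
  -- energy is again `ε` of the state.
  let R : S → S → Prop := fun s s' => G.edge s s' ∧ ε s' = ε s + G.weight s s'
  have hR : ∀ n, R (ρ.state n) (ρ.state (n + 1)) := fun n =>
    ⟨ρ.step n, by rw [← hε, ← hε, ρ.energy_succ]⟩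
  have w₁ := HasWalk.of_segment (g := fun s _ => (ε s : ℝ) - t) ρ.state (Nat.zero_le i)
    fun n _ _ => hR n
  have w₂ := HasWalk.of_segment (g := fun s _ => (ε s : ℝ) - t) ρ.state hij.le fun n _ _ => hR n
  rw [← hEq] at w₂
  simp only [hε] at hsum
  obtain ⟨r, p, q, hq, hr0, hr, hclose, hinj, hpos⟩ := exists_simple_lasso w₁ w₂ hsum
  rw [← hr0]
  refine exists_winsTwo_of_lasso h1 hq (fun i hi => (hr i hi).1) hclose hinj fun π hs hs' hπ => ?_
  have henergy : ∀ n, π.energy n = ε (r (lassoPos p q n)) := by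
    intro n
    induction n with
    | zero =>
      rw [π.energy_zero, ← ρ.energy_zero, hε, ← hr0]
      rfl
    | succ n ih =>
      rw [π.energy_succ, ih, hs', hs, ← (hr _ (lassoPos_lt hq n)).2, lassoPos_succ,
        lasso_apply_succ hclose (lassoPos_lt hq n)]
  obtain ⟨D, hD⟩ := exists_linear_lower_bound (p := p)
    (f := fun n => ∑ i ∈ range n, ((π.energy i : ℝ) - t)) hpos.le hq (by
      intro n hn
      simp only [henergy]
      rw [sum_lasso_add hq (fun i => (ε (r i) : ℝ) - t) hn])
  exact absurd hπ.2 (not_le.2 (π.lt_avgEnergy (div_pos hpos (by exact_mod_cast hq)) hD))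

/-- If the energy never gets negative, two visits of one state with different energies give a cycle
of nonzero weight; otherwise the energy is a function of the state. -/
theorem Game.exists_winsTwo_of_play_not_mem [Finite S] (h1 : G.states .one = ∅) {t : ℚ}
    (ρ : G.Play) (hρ : ρ ∉ G.AEL t) :
    ∃ σ : G.Strategy .two, WinsTwo (ρ.state 0) (G.AEL t) σ ∧ σ.Memoryless := by
  classical
  have seg : ∀ g m n, m ≤ n → HasWalk G.edge g (ρ.state m) (ρ.state n) (n - m)
      (∑ i ∈ Ico m n, g (ρ.state i) (ρ.state (i + 1))) :=
    fun g m n hmn => HasWalk.of_segment ρ.state hmn fun i _ _ => ρ.step i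
  have hdiff : ∀ m n, m ≤ n → ∑ i ∈ Ico m n, (G.weight (ρ.state i) (ρ.state (i + 1)) : ℝ) =
      ρ.energy n - ρ.energy m := by
    intro m n hmn
    rw [sum_Ico_eq_sub _ hmn]
    simp [Play.energy]
  by_cases hneg : ∃ n, ρ.energy n < 0
  · obtain ⟨n, hn⟩ := hneg
    refine exists_winsTwo_of_negative_walk h1 (seg _ 0 n (Nat.zero_le n)) ?_
    rw [sum_neg_distrib, hdiff 0 n (Nat.zero_le n), ρ.energy_zero]
    have : (ρ.energy n : ℝ) < 0 := by exact_mod_cast hn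
    push_cast
    linarith
  push Not at hneg
  have havg : ((t : ℝ) : EReal) < ρ.avgEnergy := by
    by_contra hcon
    exact hρ ⟨fun n => by simpa using hneg n, not_lt.1 hcon⟩
  by_cases hsame : ∀ m n, m < n → ρ.state m = ρ.state n → ρ.energy m = ρ.energy n
  · have hex : ∀ s, ∃ x : ℤ, ∀ n, ρ.state n = s → ρ.energy n = x := by
      intro s
      by_cases hs : ∃ n, ρ.state n = s
      · obtain ⟨m, rfl⟩ := hs
        refine ⟨ρ.energy m, fun n hn => ?_⟩
        rcases lt_trichotomy m n with h | rfl | h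
        · exact (hsame m n h hn.symm).symm
        · rfl
        · exact hsame n m h hn
      · exact ⟨0, fun n hn => absurd ⟨n, hn⟩ hs⟩
    choose ε hε using hex
    exact exists_winsTwo_of_energy_eq h1 ρ ε (fun n => hε _ n rfl) havg
  · push Not at hsame
    obtain ⟨m, n, hmn, hEq, hne⟩ := hsame
    have hd := hdiff m n hmn.le
    rcases lt_or_gt_of_ne hne with h | h
    · have h' : (ρ.energy m : ℝ) < ρ.energy n := by exact_mod_cast h
      have w := seg (fun s s' => (G.weight s s' : ℝ)) m n hmn.le
      rw [← hEq] at w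
      exact exists_winsTwo_of_positive_cycle h1 (seg _ 0 m (Nat.zero_le m)) w (by linarith)
    · have h' : (ρ.energy n : ℝ) < ρ.energy m := by exact_mod_cast h
      have w := seg (fun s s' => -(G.weight s s' : ℝ)) m n hmn.le
      rw [← hEq] at w
      exact exists_winsTwo_of_negative_cycle h1 (seg _ 0 m (Nat.zero_le m)) w
        (by rw [sum_neg_distrib]; linarith)

end Memoryless

end AvgEnergy

/-! ### Assembly of the three claims. -/

open AvgEnergy AvgEnergy.Game in
theorem mainTheorem9 :
    -- pseudo-polynomial memory suffices for player 1
    (∃ p : MvPolynomial (Fin 3) ℕ,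
      ∀ (S : Type*) [Fintype S] (G : Game S), G.OnePlayer → ∀ (s₀ : S) (t : ℚ),
        (∃ σ : G.Strategy .one, WinsOne s₀ (G.AEL t) σ) →
        ∃ (σ : G.Strategy .one) (k : ℕ), WinsOne s₀ (G.AEL t) σ ∧ σ.HasMemory k ∧
          k ≤ MvPolynomial.eval ![Fintype.card S, G.maxWeight, ⌈t⌉₊] p) ∧
    -- pseudo-polynomial memory is necessary for player 1
    (∀ U : ℕ, 1 ≤ U → ∃ (G : Game (Fin 2)) (s₀ : Fin 2) (t : ℚ),
      G.states .two = ∅ ∧ G.maxWeight = U ∧ t = (U * (U + 1) : ℚ) / (2 * U + 1) ∧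
      (∃ σ : G.Strategy .one, WinsOne s₀ (G.AEL t) σ) ∧
      ∀ σ : G.Strategy .one, WinsOne s₀ (G.AEL t) σ → ∀ k : ℕ, σ.HasMemory k → U + 1 ≤ k) ∧
    -- memoryless strategies suffice for player 2
    (∀ (S : Type*) [Fintype S] (G : Game S), G.OnePlayer → ∀ (s₀ : S) (t : ℚ),
      (∃ σ : G.Strategy .two, WinsTwo s₀ (G.AEL t) σ) →
      ∃ σ : G.Strategy .two, WinsTwo s₀ (G.AEL t) σ ∧ σ.Memoryless) := by
  -- The product counts the bounded configurations; the final `+ 1` admits the one-state machine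
  -- used when player 1 owns no state.
  refine ⟨⟨.X 0 * (.X 2 + 1 + .X 1 + .X 0 ^ 2 * (.X 1 + 1) ^ 2 + 1) + 1, ?_⟩, ?_, ?_⟩
  · rintro S _ G hG s₀ t ⟨σ, hσ⟩
    rcases hG with h1 | h2
    · refine ⟨σ, 1, hσ, ⟨⟨0, fun m _ => m, fun _ s => s⟩, fun ρ n hn => ?_⟩, by simp⟩
      exact absurd (show ρ.state n ∈ G.states .one from hn) (by simp [h1])
    -- Any strategy of the stateless opponent reduces winning to a single play.
    · obtain ⟨σ₂⟩ := nonempty_strategy_of_states_eq_empty h2 s₀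
      obtain ⟨τ, k, hτ, hk, hle⟩ :=
        exists_winsOne_hasMemory h2 (outcome_spec s₀ σ σ₂).1 (hσ σ₂)
      refine ⟨τ, k, hτ, hk, hle.trans ?_⟩
      simp
  · intro U hU
    exact ⟨counterGame U, 0, _, counterGame_states_two U, counterGame_maxWeight hU, rfl,
      counterGame_exists_winsOne U, fun σ hσ k hk => counterGame_memory_le hσ hk⟩
  · rintro S _ G hG s₀ t ⟨σ, hσ⟩
    rcases hG with h1 | h2
    · obtain ⟨σ₁⟩ := nonempty_strategy_of_states_eq_empty h1 s₀
      have h := exists_winsTwo_of_play_not_mem h1 _ (hσ σ₁)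
      rwa [(outcome_spec s₀ σ₁ σ).1] at h
    · refine ⟨σ, hσ, id, fun ρ n hn => ?_⟩
      exact absurd (show ρ.state n ∈ G.states .two from hn) (by simp [h2])
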